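/- Let $\Gamma$ be a non-elementary hyperbolic group with identity element $o$: a finitely generated group that is not virtually cyclic and all of whose word metrics $d_S$ ($S$ a finite symmetric generating set) are Gromov hyperbolic. For a function $\psi:\Gamma\times\Gamma\to\mathbb R$ put $$(x|y)^\psi_w=\tfrac12\big(\psi(x,w)+\psi(w,y)-\psi(x,y)\big),\qquad x,y,w\in\Gamma .$$ Let $\mathcal D_\Gamma$ be the set of left-invariant Gromov hyperbolic pseudo metrics $d$ on $\Gamma$ that are quasi-isometric, via the identity map, to a word metric of a finite symmetric generating set. Let $\mathcal H_\Gamma$ (the space of hyperbolic metric potentials) be the set of left-invariant functions $\psi:\Gamma\times\Gamma\to\mathbb R$ such that for every $d_0\in\mathcal D_\Gamma$ there is $\lambda>0$ with $$|(x|y)^\psi_w|\le\lambda\,(x|y)^{d_0}_w+\lambda\qquad\text{for all }x,y,w\in\Gamma .$$ Fix a reference pseudo metric $d\in\mathcal D_\Gamma$. The Gromov boundary $\partial\Gamma$ is the set of classes of sequences $\{x_n\}$ in $\Gamma$ with $(x_n|x_m)^d_o\to\infty$ as $\min\{n,m\}\to\infty$, where $\{x_n\}$ and $\{y_n\}$ are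 equivalent if $(x_n|y_m)^d_o\to\infty$ as $\min\{n,m\}\to\infty$. For $\xi\in\Gamma\cup\partial\Gamma$ write $\{x_n\}\in\xi$ if $\{x_n\}$ is a sequence in the class $\xi$ (when $\xi\in\partial\Gamma$), or is eventually constant equal to $\xi$ (when $\xi\in\Gamma$). A function $\psi:\Gamma\times\Gamma\to\mathbb R$ is a tempered potential if it is left-invariant and satisfies the following two conditions. * (QE) There are an extension of $(\cdot|\cdot)^\psi_o$ from $\Gamma^2$ to a real-valued function on $(\Gamma\cup\partial\Gamma)^2\setminus\{(\xi,\xi):\xi\in\partial\Gamma\}$ and a constant $C\ge0$ such that $$\limsup_{n\to\infty}(x_n|y_n)^\psi_o-C\le(\xi|\eta)^\psi_o\le\liminf_{n\to\infty}(x_n'|y_n')^\psi_o+C$$ for all $(\xi,\eta)$ in this domain and all $\{x_n\},\{x_n'\}\in\xi$ and $\{y_n\},\{y_n'\}\in\eta$. * (RG) For all sufficiently large $C,R\ge0$ there is $C_0\ge0$ such that for all $x,y\in\Gamma$, every map $\gamma:[a,b]\to\Gamma$ with $\gamma(a)=x$, $\gamma(b)=y$ and $\big|d(\gamma(s),\gamma(t))-|s-t|\big|\le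 C$ for all $s,t\in[a,b]$, and every $w\in\Gamma$ with $d(w,\gamma(t))\le R$ for some $t\in[a,b]$, one has $|(x|y)^\psi_w|\le C_0$. Then, for every choice of the reference pseudo metric $d\in\mathcal D_\Gamma$, $\mathcal H_\Gamma$ coincides with the space of tempered potentials on $\Gamma$. -/

import Mathlib

open Filter

/-! ### Metric notions -/

/-- The Gromov product `(x|y)_w` of an arbitrary function `ψ : X × X → ℝ`. -/
noncomputable def gromovProd {X : Type*} (ψ : X → X → ℝ) (x y w : X) : ℝ :=
  (ψ x w + ψ w y - ψ x y) / 2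

/-- `d` is a pseudo metric on `X` (nonnegativity follows from the three axioms). -/
structure IsPseudoMetric {X : Type*} (d : X → X → ℝ) : Prop where
  self_eq_zero : ∀ x, d x x = 0
  symm : ∀ x y, d x y = d y x
  triangle : ∀ x y z, d x z ≤ d x y + d y z

/-- Gromov hyperbolicity: the four-point condition for some `δ`. -/
def IsGromovHyperbolic {X : Type*} (d : X → X → ℝ) : Prop :=
  ∃ δ : ℝ, ∀ x y z w : X,
    min (gromovProd d x y w) (gromovProd d y z w) - δ ≤ gromovProd d x z w

/-- Two pseudo metrics on `X` are quasi-isometric if the identity map is a quasi-isometry. -/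
def AreQuasiIsometric {X : Type*} (d d' : X → X → ℝ) : Prop :=
  ∃ l₁ l₂ C : ℝ, 0 < l₁ ∧ 0 < l₂ ∧ 0 < C ∧
    ∀ x y, l₁ * d x y - C ≤ d' x y ∧ d' x y ≤ l₂ * d x y + C

/-- `γ`, restricted to the interval `[a, b]`, is a `(C, d)`-rough geodesic with extreme points
`x` and `y` (no continuity is required; the values of `γ` outside `[a, b]` play no role). -/
def IsRoughGeodesic {X : Type*} (d : X → X → ℝ) (C : ℝ) (γ : ℝ → X) (a b : ℝ) (x y : X) : Prop :=
  a ≤ b ∧ γ a = x ∧ γ b = y ∧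
    ∀ s ∈ Set.Icc a b, ∀ t ∈ Set.Icc a b,
      |s - t| - C ≤ d (γ s) (γ t) ∧ d (γ s) (γ t) ≤ |s - t| + C

/-! ### Hyperbolic groups -/

/-- `S` is a finite symmetric generating set of `Γ`. -/
def IsSymmGenSet {Γ : Type*} [Group Γ] (S : Set Γ) : Prop :=
  S.Finite ∧ (∀ s ∈ S, s⁻¹ ∈ S) ∧ Subgroup.closure S = ⊤

/-- Word length: the least length of a word in the letters `S` that represents `g`. -/
noncomputable def wordLength {Γ : Type*} [Group Γ] (S : Set Γ) (g : Γ) : ℕ :=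
  sInf {n : ℕ | ∃ l : List Γ, l.length = n ∧ (∀ s ∈ l, s ∈ S) ∧ l.prod = g}

/-- The word metric `d_S(x, y) = |x⁻¹ y|_S`. -/
noncomputable def wordMetric {Γ : Type*} [Group Γ] (S : Set Γ) (x y : Γ) : ℝ :=
  (wordLength S (x⁻¹ * y) : ℝ)

/-- Non-elementary hyperbolic groups: finitely generated, not virtually cyclic, and every word
metric of a finite symmetric generating set is hyperbolic. -/
structure IsNonelementaryHyperbolic (Γ : Type*) [Group Γ] : Prop where
  fg : Group.FG Γ
  not_virtually_cyclic : ¬ ∃ H : Subgroup Γ, H.FiniteIndex ∧ IsCyclic H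
  hyperbolic : ∀ S : Set Γ, IsSymmGenSet S → IsGromovHyperbolic (wordMetric S)

/-- Invariance under the left action of `Γ`. -/
def IsLeftInvariant {Γ : Type*} [Group Γ] (ψ : Γ → Γ → ℝ) : Prop :=
  ∀ s x y : Γ, ψ (s * x) (s * y) = ψ x y

/-- Membership in `𝒟_Γ`: left-invariant hyperbolic pseudo metrics on `Γ` that are quasi-isometric
to a word metric. -/
structure IsHyperbolicMetric {Γ : Type*} [Group Γ] (d : Γ → Γ → ℝ) : Prop where
  pseudoMetric : IsPseudoMetric d
  hyperbolic : IsGromovHyperbolic d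
  leftInvariant : IsLeftInvariant d
  quasiIsometric : ∃ S : Set Γ, IsSymmGenSet S ∧ AreQuasiIsometric (wordMetric S) d

/-- The space `𝒟_Γ`. -/
def HyperbolicMetric (Γ : Type*) [Group Γ] : Type _ :=
  {d : Γ → Γ → ℝ // IsHyperbolicMetric d}

/-- The space `ℋ_Γ` of hyperbolic metric potentials. -/
def hyperbolicMetricPotentials (Γ : Type*) [Group Γ] : Set (Γ → Γ → ℝ) :=
  {ψ | IsLeftInvariant ψ ∧
    ∀ d₀ : HyperbolicMetric Γ, ∃ l : ℝ, 0 < l ∧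
      ∀ x y w : Γ, |gromovProd ψ x y w| ≤ l * gromovProd d₀.1 x y w + l}

/-! ### The Gromov boundary -/

/-- `(x_n|y_m)_o` tends to infinity as `min {n, m}` tends to infinity. -/
def GromovProdTendsto {Γ : Type*} [Group Γ] (d : Γ → Γ → ℝ) (x y : ℕ → Γ) : Prop :=
  Tendsto (fun p : ℕ × ℕ => gromovProd d (x p.1) (y p.2) 1) atTop atTop

/-- Sequences in `Γ` that diverge with respect to `d`. -/
def DivergentSeq {Γ : Type*} [Group Γ] (d : HyperbolicMetric Γ) : Type _ :=
  {x : ℕ → Γ // GromovProdTendsto d.1 x x}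

theorem gromovProdTendsto_symm {Γ : Type*} [Group Γ] (d : HyperbolicMetric Γ) {x y : ℕ → Γ}
    (h : GromovProdTendsto d.1 x y) : GromovProdTendsto d.1 y x := by
  have hs : Tendsto (Prod.swap : ℕ × ℕ → ℕ × ℕ) atTop atTop := by
    rw [← prod_atTop_atTop_eq]
    exact tendsto_prod_swap
  have h2 := Tendsto.comp h hs
  refine h2.congr fun p => ?_
  have e := d.2.pseudoMetric.symm
  simp only [Function.comp, gromovProd, Prod.fst_swap, Prod.snd_swap]
  rw [e (x p.2) 1, e 1 (y p.1), e (x p.2) (y p.1)]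
  ring

theorem gromovProdTendsto_trans {Γ : Type*} [Group Γ] (d : HyperbolicMetric Γ) {x y z : ℕ → Γ}
    (h : GromovProdTendsto d.1 x y) (h' : GromovProdTendsto d.1 y z) :
    GromovProdTendsto d.1 x z := by
  obtain ⟨δ, hδ⟩ := d.2.hyperbolic
  have h1 : Tendsto (fun p : ℕ × ℕ => (p.1, max p.1 p.2)) atTop atTop := by
    refine tendsto_atTop_mono (f := fun p : ℕ × ℕ => (p.1, p.2)) ?_ tendsto_id
    intro p
    exact ⟨le_refl _, le_max_right _ _⟩
  have h2 : Tendsto (fun p : ℕ × ℕ => (max p.1 p.2, p.2)) atTop atTop := by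
    refine tendsto_atTop_mono (f := fun p : ℕ × ℕ => (p.1, p.2)) ?_ tendsto_id
    intro p
    exact ⟨le_max_left _ _, le_refl _⟩
  have g1 := Tendsto.comp h h1
  have g2 := Tendsto.comp h' h2
  rw [tendsto_atTop] at g1 g2
  refine tendsto_atTop.2 fun K => ?_
  filter_upwards [g1 (K + δ), g2 (K + δ)] with p hp1 hp2
  have := hδ (x p.1) (y (max p.1 p.2)) (z p.2) 1
  have hm := le_min hp1 hp2
  simp only [Function.comp] at hm
  linarith

/-- Equivalence of divergent sequences. -/
instance boundarySetoid {Γ : Type*} [Group Γ] (d : HyperbolicMetric Γ) :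
    Setoid (DivergentSeq d) where
  r x y := GromovProdTendsto d.1 x.1 y.1
  iseqv :=
    { refl := fun x => x.2
      symm := fun h => gromovProdTendsto_symm d h
      trans := fun h h' => gromovProdTendsto_trans d h h' }

/-- The Gromov boundary `∂Γ`, computed with the reference metric `d`. -/
def GromovBoundary {Γ : Type*} [Group Γ] (d : HyperbolicMetric Γ) : Type _ :=
  Quotient (boundarySetoid d)

/-- `{x_n} ∈ ξ` for `ξ ∈ Γ ∪ ∂Γ`: the sequence is eventually constant equal to `ξ` if `ξ ∈ Γ`, and
it is a divergent sequence in the class `ξ` if `ξ ∈ ∂Γ`. -/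
def Represents {Γ : Type*} [Group Γ] (d : HyperbolicMetric Γ) (x : ℕ → Γ) :
    Γ ⊕ GromovBoundary d → Prop
  | Sum.inl g => ∀ᶠ n in atTop, x n = g
  | Sum.inr ξ => ∃ h : GromovProdTendsto d.1 x x, Quotient.mk (boundarySetoid d) ⟨x, h⟩ = ξ

/-! ### Tempered potentials -/

/-- The quasi-extension condition. The function `E` extends the Gromov product based at the
identity, and the two-sided estimate holds at all pairs of points of `Γ ∪ ∂Γ` except
the pairs `(ξ, ξ)` with `ξ ∈ ∂Γ`. The upper and lower limits are taken in `[-∞, ∞]`. -/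
def QuasiExtension {Γ : Type*} [Group Γ] (d : HyperbolicMetric Γ) (ψ : Γ → Γ → ℝ) : Prop :=
  ∃ E : Γ ⊕ GromovBoundary d → Γ ⊕ GromovBoundary d → ℝ,
    (∀ x y : Γ, E (Sum.inl x) (Sum.inl y) = gromovProd ψ x y 1) ∧
    ∃ C : ℝ, 0 ≤ C ∧
      ∀ ξ η : Γ ⊕ GromovBoundary d,
        (¬ ∃ ζ : GromovBoundary d, ξ = Sum.inr ζ ∧ η = Sum.inr ζ) →
        ∀ x x' y y' : ℕ → Γ, Represents d x ξ → Represents d x' ξ →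
          Represents d y η → Represents d y' η →
          limsup (fun n => ((gromovProd ψ (x n) (y n) 1 : ℝ) : EReal)) atTop - (C : EReal)
              ≤ ((E ξ η : ℝ) : EReal) ∧
            ((E ξ η : ℝ) : EReal)
              ≤ liminf (fun n => ((gromovProd ψ (x' n) (y' n) 1 : ℝ) : EReal)) atTop + (C : EReal)

/-- The rough geodesic condition with respect to the reference metric `d`. -/
def RoughGeodesicCondition {Γ : Type*} [Group Γ] (d : HyperbolicMetric Γ) (ψ : Γ → Γ → ℝ) : Prop :=
  ∃ M : ℝ, 0 ≤ M ∧ ∀ C R : ℝ, M ≤ C → M ≤ R →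
    ∃ C₀ : ℝ, 0 ≤ C₀ ∧
      ∀ (x y : Γ) (γ : ℝ → Γ) (a b : ℝ), IsRoughGeodesic d.1 C γ a b x y →
        ∀ w : Γ, (∃ t ∈ Set.Icc a b, d.1 w (γ t) ≤ R) → |gromovProd ψ x y w| ≤ C₀

/-- The space of tempered potentials on `Γ`, with `d` as reference metric. -/
def temperedPotentials {Γ : Type*} [Group Γ] (d : HyperbolicMetric Γ) : Set (Γ → Γ → ℝ) :=
  {ψ | IsLeftInvariant ψ ∧ QuasiExtension d ψ ∧ RoughGeodesicCondition d ψ}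

/-! ### Four-point hyperbolicity -/

/-! Any two metrics in `𝒟_Γ` have linearly comparable Gromov products, so $\psi\in\mathcal H_\Gamma$
only has to be tested against the reference metric $d$ (`mem_hyperbolicMetricPotentials_iff`). The
theorem becomes: a left-invariant $\psi$ is controlled by $d$ if and only if (QE) and (RG) hold.

The comparison of metrics rests on the Morse lemma (`IsQuasiGeodesic.exists_gromovProd_le`). As
$\Gamma$ need not contain the points of a $d$-geodesic, these are replaced by virtual points, known
only through their distances to $\Gamma$. The lemma turns word geodesics into rough geodesics of $d$
that are simultaneously tight for another metric of `𝒟_Γ`.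

For potentials the tool is the identity `gromovProd_sub_eq`: if $p$ is a center of the triangle
$x,y,w$ and $\psi$-products at $p$ are bounded, then $(x|y)^\psi_w$ is
$\tfrac12(\psi(p,w)+\psi(w,p))$ up to a constant, and $d(w,p)$ is $(x|y)^d_w$ up to a constant.

Control gives (RG) at once. It gives (QE) because moving a vertex without changing $d$-products much
keeps the same center, hence changes $\psi$-products boundedly; sequences with the same limits are
related in this way. Conversely, (RG) bounds the products at centers and makes $\psi$ grow at most
linearly, so the identity yields control; (QE) is then a consequence. -/

/-- The four-point condition in additive form. -/
def FourPoint {X : Type*} (d : X → X → ℝ) (δ : ℝ) : Prop :=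
  ∀ a b c e : X, d a b + d c e ≤ d a c + d b e + 2 * δ ∨ d a b + d c e ≤ d a e + d b c + 2 * δ

theorem IsGromovHyperbolic.exists_fourPoint {X : Type*} {d : X → X → ℝ} (hd : IsPseudoMetric d)
    (h : IsGromovHyperbolic d) : ∃ δ : ℝ, 0 ≤ δ ∧ FourPoint d δ := by
  obtain ⟨δ, hδ⟩ := h
  refine ⟨max δ 0, le_max_right _ _, fun a b c e => ?_⟩
  have h1 := hδ a c b e
  have h2 := le_max_left δ 0
  simp only [gromovProd] at h1
  have := hd.symm c b
  have := hd.symm e b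
  have := hd.symm e c
  rcases min_choice ((d a e + d e c - d a c) / 2) ((d c e + d e b - d c b) / 2) with h3 | h3 <;>
    rw [h3] at h1
  · left; linarith
  · right; linarith

theorem IsPseudoMetric.nonneg {X : Type*} {d : X → X → ℝ} (hd : IsPseudoMetric d) (x y : X) :
    0 ≤ d x y := by
  have h1 := hd.triangle x y x
  have h2 := hd.symm x y
  have h3 := hd.self_eq_zero x
  linarith

theorem IsPseudoMetric.gromovProd_nonneg {X : Type*} {d : X → X → ℝ} (hd : IsPseudoMetric d)
    (x y w : X) : 0 ≤ gromovProd d x y w := by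
  have := hd.triangle x w y
  unfold gromovProd
  linarith

/-- The distance from `z` to the point at distance `t` from `x` on a virtual geodesic
from `x` to `y`. -/
noncomputable def virtualDist {X : Type*} (d : X → X → ℝ) (x y : X) (t : ℝ) (z : X) : ℝ :=
  max (d z x - t) (d z y - (d x y - t))

section Virtual

variable {X : Type*} {d : X → X → ℝ} {x y : X}

theorem virtualDist_le_add (hd : IsPseudoMetric d) (t : ℝ) (z z' : X) :
    virtualDist d x y t z' ≤ virtualDist d x y t z + d z z' := by
  have h1 := le_max_left (d z x - t) (d z y - (d x y - t))
  have h2 := le_max_right (d z x - t) (d z y - (d x y - t))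
  have := hd.triangle z' z x
  have := hd.triangle z' z y
  have := hd.symm z z'
  unfold virtualDist
  refine max_le ?_ ?_ <;> linarith

theorem virtualDist_le_add_abs (t t' : ℝ) (z : X) :
    virtualDist d x y t' z ≤ virtualDist d x y t z + |t - t'| := by
  have h1 := le_max_left (d z x - t) (d z y - (d x y - t))
  have h2 := le_max_right (d z x - t) (d z y - (d x y - t))
  have := le_abs_self (t - t')
  have := neg_abs_le (t - t')
  unfold virtualDist
  refine max_le ?_ ?_ <;> linarith

theorem virtualDist_left_le (hd : IsPseudoMetric d) {t : ℝ} (ht : 0 ≤ t) :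
    virtualDist d x y t x ≤ t := by
  have := hd.self_eq_zero x
  unfold virtualDist
  refine max_le ?_ ?_ <;> linarith

theorem virtualDist_right_le (hd : IsPseudoMetric d) {t : ℝ} (ht : t ≤ d x y) :
    virtualDist d x y t y ≤ d x y - t := by
  have := hd.self_eq_zero y
  have := hd.symm x y
  unfold virtualDist
  refine max_le ?_ ?_ <;> linarith

/-- The triangle inequality through the virtual point: it comes from the four-point condition for
`z, z', x, y`, which is where the loss `2 * δ` arises. -/
theorem dist_le_virtualDist_add {δ : ℝ} (h4 : FourPoint d δ)
    (t : ℝ) (z z' : X) :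
    d z z' ≤ virtualDist d x y t z + virtualDist d x y t z' + 2 * δ := by
  have h1 := le_max_left (d z x - t) (d z y - (d x y - t))
  have h2 := le_max_right (d z x - t) (d z y - (d x y - t))
  have h1' := le_max_left (d z' x - t) (d z' y - (d x y - t))
  have h2' := le_max_right (d z' x - t) (d z' y - (d x y - t))
  unfold virtualDist
  rcases h4 z z' x y with h | h <;> linarith

theorem gromovProd_le_virtualDist (hd : IsPseudoMetric d) (t : ℝ) (z : X) :
    gromovProd d x y z ≤ virtualDist d x y t z := by
  have h1 := le_max_left (d z x - t) (d z y - (d x y - t))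
  have h2 := le_max_right (d z x - t) (d z y - (d x y - t))
  have := hd.symm x z
  unfold virtualDist gromovProd
  linarith

/-- The four-point condition persists when a virtual point is added. -/
theorem virtualDist_fourPoint (hd : IsPseudoMetric d) {δ : ℝ} (h4 : FourPoint d δ)
    (t : ℝ) (a b c : X) :
    d a c + virtualDist d x y t b ≤ d a b + virtualDist d x y t c + 2 * δ ∨
      d a c + virtualDist d x y t b ≤ d b c + virtualDist d x y t a + 2 * δ := by
  have a1 := le_max_left (d a x - t) (d a y - (d x y - t))
  have a2 := le_max_right (d a x - t) (d a y - (d x y - t))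
  have c1 := le_max_left (d c x - t) (d c y - (d x y - t))
  have c2 := le_max_right (d c x - t) (d c y - (d x y - t))
  have := hd.symm b c
  unfold virtualDist
  rcases max_choice (d b x - t) (d b y - (d x y - t)) with h | h <;> rw [h]
  · rcases h4 a c b x with h | h
    · left; linarith
    · right; linarith
  · rcases h4 a c b y with h | h
    · left; linarith
    · right; linarith

/-- A virtual point separates the points on its left from those on its right. -/
theorem virtualDist_add_le (hd : IsPseudoMetric d) {δ : ℝ} (h4 : FourPoint d δ)
    {t : ℝ} {z z' : X} (hz : d z x ≤ t) (hz' : d z' y ≤ d x y - t) :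
    virtualDist d x y t z + virtualDist d x y t z' ≤ d z z' + 2 * δ := by
  have e1 : virtualDist d x y t z = d z y - (d x y - t) := by
    unfold virtualDist
    apply max_eq_right
    have := hd.triangle x z y
    have := hd.symm x z
    linarith
  have e2 : virtualDist d x y t z' = d z' x - t := by
    unfold virtualDist
    apply max_eq_left
    have := hd.triangle x z' y
    have := hd.symm x z'
    linarith
  rw [e1, e2]
  have := hd.nonneg z z'
  have := hd.symm y z'
  have := hd.symm y x
  rcases h4 z y z' x with h | h <;> linarith

/-- Chains that avoid a ball around a virtual point of a geodesic lose only a logarithm. -/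
theorem virtualDist_chain (hd : IsPseudoMetric d) {δ : ℝ} (h4 : FourPoint d δ)
    {t H K : ℝ} (hK : 0 ≤ K) (z : ℕ → X) (k : ℕ) : ∀ i m : ℕ, m ≤ 2 ^ k →
      (∀ l, i ≤ l → l ≤ i + m → H ≤ virtualDist d x y t (z l)) →
      (∀ l, i ≤ l → l < i + m → d (z l) (z (l + 1)) ≤ K) →
      2 * H - K - 2 * δ * k ≤
        virtualDist d x y t (z i) + virtualDist d x y t (z (i + m)) - d (z i) (z (i + m)) := by
  induction k with
  | zero =>
    intro i m hm hH hs
    have h1 := hH i le_rfl (by omega)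
    have h2 := hH (i + m) (by omega) le_rfl
    have h3 : d (z i) (z (i + m)) ≤ K := by
      rcases Nat.le_one_iff_eq_zero_or_eq_one.1 (by simpa using hm) with rfl | rfl
      · simpa [hd.self_eq_zero] using hK
      · exact hs i le_rfl (by omega)
    simp only [Nat.cast_zero]
    linarith
  | succ k ih =>
    intro i m hm hH hs
    rw [pow_succ] at hm
    have h1 := ih i (m / 2) (by omega) (fun l hl hl' => hH l hl (by omega))
      (fun l hl hl' => hs l hl (by omega))
    have h2 := ih (i + m / 2) (m - m / 2) (by omega) (fun l hl hl' => hH l (by omega) (by omega))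
      (fun l hl hl' => hs l (by omega) (by omega))
    have e : i + m / 2 + (m - m / 2) = i + m := by omega
    rw [e] at h2
    push_cast
    -- The right-hand side is twice the Gromov product at the virtual point; each halving of the
    -- chain costs `2 * δ`.
    rcases virtualDist_fourPoint (x := x) (y := y) hd h4 t (z i) (z (i + m / 2)) (z (i + m))
      with h | h <;> nlinarith

end Virtual

/-! ### Stability of quasi-geodesics -/

/-- `z 0, …, z n` is a discrete quasi-geodesic for `d`. -/
def IsQuasiGeodesic {X : Type*} (d : X → X → ℝ) (A : ℝ) (z : ℕ → X) (n : ℕ) : Prop :=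
  ∀ i j : ℕ, i ≤ j → j ≤ n →
    d (z i) (z j) ≤ A * ((j : ℝ) - i) ∧ (j : ℝ) - i ≤ A * d (z i) (z j) + A

theorem IsQuasiGeodesic.shift {X : Type*} {d : X → X → ℝ} {A : ℝ} {z : ℕ → X} {n : ℕ}
    (h : IsQuasiGeodesic d A z n) {i k : ℕ} (hk : i + k ≤ n) :
    IsQuasiGeodesic d A (fun l => z (i + l)) k := by
  intro a b hab hb
  have := h (i + a) (i + b) (by omega) (by omega)
  push_cast at this
  simpa using this

theorem exists_linear_le_two_pow (a b : ℝ) : ∃ k₀ : ℕ, ∀ k : ℕ, k₀ ≤ k → a * k + b ≤ 2 ^ k := by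
  have h1 : Tendsto (fun k : ℕ => (k : ℝ) ^ 1 / 2 ^ k) atTop (nhds 0) :=
    tendsto_pow_const_div_const_pow_of_one_lt 1 (by norm_num)
  have h2 : Tendsto (fun k : ℕ => (k : ℝ) ^ 0 / 2 ^ k) atTop (nhds 0) :=
    tendsto_pow_const_div_const_pow_of_one_lt 0 (by norm_num)
  have h3 := (h1.const_mul a).add (h2.const_mul b)
  simp only [mul_zero, add_zero] at h3
  obtain ⟨k₀, hk⟩ := eventually_atTop.1 (h3.eventually (gt_mem_nhds one_pos))
  refine ⟨k₀, fun k hk' => ?_⟩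
  have h4 := hk k hk'
  have h5 : (0 : ℝ) < 2 ^ k := by positivity
  have h6 : (a * k + b) / 2 ^ k < 1 := by
    rw [show (a * k + b) / 2 ^ k = a * ((k : ℝ) ^ 1 / 2 ^ k) + b * ((k : ℝ) ^ 0 / 2 ^ k) by
      rw [pow_one, pow_zero]; ring]
    exact h4
  rw [div_lt_one h5] at h6
  exact h6.le

section Morse

variable {X : Type*} {d : X → X → ℝ}

/-- If every virtual point lies within `D` of the quasi-geodesic, then it even lies
within `D - 1`, unless `D` is small. -/
theorem IsQuasiGeodesic.improve (hd : IsPseudoMetric d) {δ : ℝ} (hδ : 0 ≤ δ)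
    (h4 : FourPoint d δ) {A : ℝ} (hA : 0 ≤ A) :
    ∃ D₀ : ℝ, 0 ≤ D₀ ∧ ∀ (z : ℕ → X) (n : ℕ), IsQuasiGeodesic d A z n → ∀ D, D₀ ≤ D →
      (∀ t, 0 ≤ t → t ≤ d (z 0) (z n) → ∃ i ≤ n, virtualDist d (z 0) (z n) t (z i) ≤ D) →
      ∀ t, 0 ≤ t → t ≤ d (z 0) (z n) → ∃ i ≤ n, virtualDist d (z 0) (z n) t (z i) ≤ D - 1 := by
  -- The linear function of `k` bounds the length of the chain used below when `D` is about `k * (δ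
  -- + 1)`: exponential beats linear, so `k` halvings suffice.
  obtain ⟨k₀, hk₀⟩ := exists_linear_le_two_pow (A * 4 * (δ + 1))
    (A * (4 * ((δ + 1) + (A + δ + 2)) + 2 * δ) + A)
  refine ⟨(k₀ + 1) * (δ + 1) + (A + δ + 2), by positivity, fun z n hz D hD hP t ht htL => ?_⟩
  by_contra hcon
  push Not at hcon
  have hD0 : 0 ≤ D := le_trans (by positivity) hD
  set L := d (z 0) (z n) with hL
  -- An index near the virtual point at `t - D` lies to the left of height `t`; if that height is
  -- negative, the endpoint serves. The index `j` below is its mirror image.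
  obtain ⟨i, hi, hi1, hi2⟩ : ∃ i ≤ n, d (z i) (z 0) ≤ t ∧
      virtualDist d (z 0) (z n) t (z i) ≤ 2 * D := by
    rcases le_total D t with h | h
    · obtain ⟨i, hi, hi'⟩ := hP (t - D) (by linarith) (by linarith)
      refine ⟨i, hi, ?_, ?_⟩
      · have := le_max_left (d (z i) (z 0) - (t - D)) (d (z i) (z n) - (d (z 0) (z n) - (t - D)))
        unfold virtualDist at hi'
        linarith
      · have := virtualDist_le_add_abs (d := d) (x := z 0) (y := z n) (t - D) t (z i)
        rw [abs_of_nonpos (by linarith)] at this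
        linarith
    · refine ⟨0, by omega, by rw [hd.self_eq_zero]; exact ht, ?_⟩
      have := virtualDist_left_le (y := z n) hd (x := z 0) ht
      linarith
  obtain ⟨j, hj, hj1, hj2⟩ : ∃ j ≤ n, d (z j) (z n) ≤ d (z 0) (z n) - t ∧
      virtualDist d (z 0) (z n) t (z j) ≤ 2 * D := by
    rcases le_total (t + D) L with h | h
    · obtain ⟨j, hj, hj'⟩ := hP (t + D) (by linarith) (by linarith)
      refine ⟨j, hj, ?_, ?_⟩
      · have := le_max_right (d (z j) (z 0) - (t + D))
          (d (z j) (z n) - (d (z 0) (z n) - (t + D)))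
        unfold virtualDist at hj'
        linarith
      · have := virtualDist_le_add_abs (d := d) (x := z 0) (y := z n) (t + D) t (z j)
        rw [abs_of_nonneg (by linarith)] at this
        linarith
    · refine ⟨n, le_rfl, by rw [hd.self_eq_zero]; linarith, ?_⟩
      have := virtualDist_right_le hd htL
      linarith
  have hsep := virtualDist_add_le hd h4 hi1 hj1
  have hdist := dist_le_virtualDist_add (x := z 0) (y := z n) h4 t (z i) (z j)
  -- the number of dyadic steps
  set k := ⌊(D - (A + δ + 2)) / (δ + 1)⌋₊ with hk
  have hδ1 : (0 : ℝ) < δ + 1 := by linarith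
  have hq0 : (k₀ : ℝ) + 1 ≤ (D - (A + δ + 2)) / (δ + 1) := by
    rw [le_div_iff₀ hδ1]; linarith
  have hkk : k₀ ≤ k := Nat.le_floor (by linarith)
  have hk1 : (k : ℝ) * (δ + 1) ≤ D - (A + δ + 2) := by
    rw [← le_div_iff₀ hδ1]
    exact Nat.floor_le (le_trans (by positivity) hq0)
  have hk2 : D - (A + δ + 2) < (k + 1) * (δ + 1) := by
    rw [← div_lt_iff₀ hδ1]
    exact Nat.lt_floor_add_one _
  have hpow := hk₀ k hkk
  -- A stretch avoiding the ball of radius `D - 1` whose ends are separated by the virtual point: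
  -- separation makes the product there at most `δ`, while its at most `2 ^ k` steps force it to be
  -- larger. The choice of `k` ensures both.
  have key : ∀ p q : ℕ, p ≤ q → q ≤ n → d (z p) (z q) ≤ 4 * D + 2 * δ →
      virtualDist d (z 0) (z n) t (z p) + virtualDist d (z 0) (z n) t (z q)
        ≤ d (z p) (z q) + 2 * δ → False := by
    intro p q hpq hq h1 h2
    have h3 := (hz p q hpq hq).2
    obtain ⟨m, rfl⟩ := Nat.exists_eq_add_of_le hpq
    have hm : m ≤ 2 ^ k := by
      have : (m : ℝ) ≤ 2 ^ k := by
        push_cast at h3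
        have h5 : A * d (z p) (z (p + m)) ≤
            A * (4 * ((k + 1) * (δ + 1) + (A + δ + 2)) + 2 * δ) :=
          mul_le_mul_of_nonneg_left (by linarith) hA
        refine le_trans ?_ hpow
        nlinarith
      exact_mod_cast this
    have hc := virtualDist_chain (x := z 0) (y := z n) (t := t) hd h4 hA z k p m hm
      (H := D - 1) (fun l hl hl' => (hcon l (by omega)).le)
      (fun l hl hl' => by
        have := (hz l (l + 1) (by omega) (by omega)).1
        push_cast at this
        linarith)
    have : δ * k ≤ (k : ℝ) * (δ + 1) := by
      have : (0 : ℝ) ≤ k := by positivity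
      nlinarith
    linarith
  rcases le_total i j with hij | hij
  · exact key i j hij hj (by linarith) hsep
  · refine key j i hij hi ?_ ?_
    · rw [hd.symm]; linarith
    · rw [hd.symm (z j)]; linarith

/-- Virtual points of a geodesic are close to quasi-geodesics with the same end points. -/
theorem IsQuasiGeodesic.exists_virtualDist_le (hd : IsPseudoMetric d) {δ : ℝ} (hδ : 0 ≤ δ)
    (h4 : FourPoint d δ) {A : ℝ} (hA : 0 ≤ A) :
    ∃ D₀ : ℝ, 0 ≤ D₀ ∧ ∀ (z : ℕ → X) (n : ℕ), IsQuasiGeodesic d A z n →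
      ∀ t, 0 ≤ t → t ≤ d (z 0) (z n) → ∃ i ≤ n, virtualDist d (z 0) (z n) t (z i) ≤ D₀ := by
  obtain ⟨D₀, hD₀, h⟩ := IsQuasiGeodesic.improve hd hδ h4 hA
  refine ⟨D₀, hD₀, fun z n hz => ?_⟩
  -- Descent by unit steps from a radius at which the starting point alone is close enough.
  have main : ∀ m : ℕ,
      (∀ t, 0 ≤ t → t ≤ d (z 0) (z n) → ∃ i ≤ n, virtualDist d (z 0) (z n) t (z i) ≤ D₀ + m) →
      ∀ t, 0 ≤ t → t ≤ d (z 0) (z n) → ∃ i ≤ n, virtualDist d (z 0) (z n) t (z i) ≤ D₀ := by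
    intro m
    induction m with
    | zero => simp
    | succ m ih =>
      intro hm
      apply ih
      have := h z n hz (D₀ + (m + 1 : ℕ)) (by simp; positivity) hm
      convert this using 7
      push_cast; ring
  obtain ⟨m, hm⟩ := exists_nat_ge (d (z 0) (z n))
  refine main m fun t ht ht' => ⟨0, by omega, ?_⟩
  have := virtualDist_left_le (y := z n) hd (x := z 0) ht
  linarith

/-- The Morse lemma for quasi-geodesics: the Gromov product of the end points based at an
intermediate point is bounded. -/
theorem IsQuasiGeodesic.exists_gromovProd_le (hd : IsPseudoMetric d) (hh : IsGromovHyperbolic d)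
    {A : ℝ} (hA : 0 ≤ A) :
    ∃ C : ℝ, 0 ≤ C ∧ ∀ (z : ℕ → X) (n : ℕ), IsQuasiGeodesic d A z n →
      ∀ i j k, i ≤ j → j ≤ k → k ≤ n → gromovProd d (z i) (z k) (z j) ≤ C := by
  obtain ⟨δ, hδ, h4⟩ := hh.exists_fourPoint hd
  obtain ⟨D, hD, h⟩ := IsQuasiGeodesic.exists_virtualDist_le hd hδ h4 hA
  refine ⟨D + A * (A * (2 * D + 1 + 2 * δ) + A), by positivity, ?_⟩
  have main : ∀ (z : ℕ → X) (n : ℕ), IsQuasiGeodesic d A z n → ∀ k ≤ n,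
      gromovProd d (z 0) (z n) (z k) ≤ D + A * (A * (2 * D + 1 + 2 * δ) + A) := by
    intro z n hz k hk
    have hcl := h z n hz
    set L := d (z 0) (z n) with hL
    have hL0 : 0 ≤ L := hd.nonneg _ _
    -- Discrete connectedness: at the first integer height approximated by an index after `k`, the
    -- preceding height is approximated only by indices before `k`. These two indices are then close
    -- in $d$, hence close as integers, and they trap `k`.
    let V : ℕ → Prop := fun m => ∃ j, k ≤ j ∧ j ≤ n ∧
      virtualDist d (z 0) (z n) (min (m : ℝ) L) (z j) ≤ D
    have hV : ∃ m, V m := by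
      obtain ⟨m, hm⟩ := exists_nat_ge L
      refine ⟨m, n, hk, le_rfl, ?_⟩
      rw [min_eq_right hm]
      have := virtualDist_right_le (x := z 0) (y := z n) hd le_rfl
      linarith
    obtain ⟨i, j, t, t', hik, hkj, hj, hi', hj', htt⟩ : ∃ (i j : ℕ) (t t' : ℝ), i ≤ k ∧ k ≤ j ∧
        j ≤ n ∧ virtualDist d (z 0) (z n) t (z i) ≤ D ∧
        virtualDist d (z 0) (z n) t' (z j) ≤ D ∧ |t' - t| ≤ 1 := by
      classical
      obtain ⟨j, hkj, hj, hjD⟩ := Nat.find_spec hV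
      rcases Nat.eq_zero_or_pos (Nat.find hV) with h0 | h0
      · rw [h0] at hjD
        simp only [Nat.cast_zero, min_eq_left hL0] at hjD
        refine ⟨0, j, 0, 0, by omega, hkj, hj, ?_, hjD, by simp⟩
        have := virtualDist_left_le (y := z n) hd (x := z 0) le_rfl
        linarith
      · obtain ⟨m, hm⟩ := Nat.exists_eq_succ_of_ne_zero h0.ne'
        have hnot : ¬ V m := Nat.find_min hV (by omega)
        rw [hm] at hjD
        obtain ⟨i, hi, hiD⟩ := hcl (min (m : ℝ) L) (le_min (by positivity) hL0)
          (min_le_right _ _)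
        have hik : i ≤ k := by
          by_contra hc
          exact hnot ⟨i, by omega, hi, hiD⟩
        refine ⟨i, j, _, _, hik, hkj, hj, hiD, hjD, ?_⟩
        refine le_trans (abs_min_sub_min_le_max _ _ _ _) ?_
        simp
    have h1 := virtualDist_le_add_abs (d := d) (x := z 0) (y := z n) t' t (z j)
    have h2 := dist_le_virtualDist_add (x := z 0) (y := z n) h4 t (z i) (z j)
    have h3 := (hz i j (by omega) hj).2
    have h4 := (hz i k hik hk).1
    have h5 := virtualDist_le_add (x := z 0) (y := z n) hd t (z i) (z k)
    have h6 := gromovProd_le_virtualDist (x := z 0) (y := z n) hd t (z k)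
    have h7 : A * d (z i) (z j) ≤ A * (2 * D + 1 + 2 * δ) :=
      mul_le_mul_of_nonneg_left (by linarith) hA
    have hkj' : (k : ℝ) ≤ j := by exact_mod_cast hkj
    have h8 : A * ((k : ℝ) - i) ≤ A * (A * (2 * D + 1 + 2 * δ) + A) :=
      mul_le_mul_of_nonneg_left (by linarith) hA
    linarith
  intro z n hz i j k hij hjk hk
  have := main (fun l => z (i + l)) (k - i) (hz.shift (by omega)) (j - i) (by omega)
  simpa [Nat.add_sub_of_le hij, Nat.add_sub_of_le (hij.trans hjk)] using this

end Morse

/-! ### Word metrics -/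

section Word

variable {Γ : Type*} [Group Γ] {S : Set Γ}

theorem IsSymmGenSet.exists_list (hS : IsSymmGenSet S) (g : Γ) :
    ∃ l : List Γ, l.length = wordLength S g ∧ (∀ s ∈ l, s ∈ S) ∧ l.prod = g := by
  refine Nat.sInf_mem (s := {n : ℕ | ∃ l : List Γ, l.length = n ∧ (∀ s ∈ l, s ∈ S) ∧ l.prod = g}) ?_
  have hg : g ∈ (Subgroup.closure S).toSubmonoid := by rw [hS.2.2]; trivial
  rw [Subgroup.closure_toSubmonoid] at hg
  obtain ⟨l, hl, hp⟩ := Submonoid.exists_list_of_mem_closure hg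
  refine ⟨l.length, l, rfl, fun s hs => ?_, hp⟩
  rcases hl s hs with h | h
  · exact h
  · simpa using hS.2.1 _ h

theorem wordLength_prod_le {l : List Γ} (hl : ∀ s ∈ l, s ∈ S) : wordLength S l.prod ≤ l.length :=
  Nat.sInf_le ⟨l, rfl, hl, rfl⟩

theorem wordMetric_self (S : Set Γ) (x : Γ) : wordMetric S x x = 0 := by
  have : wordLength S (1 : Γ) ≤ 0 := wordLength_prod_le (l := []) (by simp)
  simp only [wordMetric, inv_mul_cancel, Nat.cast_eq_zero]
  omega

theorem wordMetric_leftInvariant (S : Set Γ) : IsLeftInvariant (wordMetric S) := by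
  intro s x y
  simp [wordMetric, mul_assoc]

theorem IsSymmGenSet.wordMetric_triangle (hS : IsSymmGenSet S) (x y z : Γ) :
    wordMetric S x z ≤ wordMetric S x y + wordMetric S y z := by
  obtain ⟨l, hl, hlS, hlp⟩ := hS.exists_list (x⁻¹ * y)
  obtain ⟨l', hl', hlS', hlp'⟩ := hS.exists_list (y⁻¹ * z)
  have h := wordLength_prod_le (S := S) (l := l ++ l') (by
    intro s hs
    rcases List.mem_append.1 hs with h | h
    exacts [hlS s h, hlS' s h])
  rw [List.prod_append, hlp, hlp', List.length_append, hl, hl'] at h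
  have e : x⁻¹ * y * (y⁻¹ * z) = x⁻¹ * z := by group
  rw [e] at h
  unfold wordMetric
  exact_mod_cast h

/-- Any two points are joined by a geodesic of the word metric. -/
theorem IsSymmGenSet.exists_geodesic (hS : IsSymmGenSet S) (x y : Γ) :
    ∃ (z : ℕ → Γ) (n : ℕ), z 0 = x ∧ z n = y ∧
      ∀ i j : ℕ, i ≤ j → j ≤ n → wordMetric S (z i) (z j) = (j : ℝ) - i := by
  obtain ⟨l, hl, hlS, hlp⟩ := hS.exists_list (x⁻¹ * y)
  let z : ℕ → Γ := fun i => x * (l.take i).prod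
  have h0 : z 0 = x := by simp [z]
  have hn : z l.length = y := by simp [z, hlp]
  have hle : ∀ i j : ℕ, i ≤ j → wordMetric S (z i) (z j) ≤ (j : ℝ) - i := by
    intro i j hij
    obtain ⟨m, rfl⟩ := Nat.exists_eq_add_of_le hij
    have e : (z i)⁻¹ * z (i + m) = ((l.drop i).take m).prod := by
      simp only [z]
      rw [List.take_add, List.prod_append]
      group
    have h := wordLength_prod_le (S := S) (l := (l.drop i).take m)
      (fun s hs => hlS s (List.mem_of_mem_drop (List.mem_of_mem_take hs)))
    have h' := h.trans (List.length_take_le _ _)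
    unfold wordMetric
    rw [e]
    push_cast
    have : (wordLength S ((l.drop i).take m).prod : ℝ) ≤ m := by exact_mod_cast h'
    linarith
  refine ⟨z, l.length, h0, hn, fun i j hij hj => le_antisymm (hle i j hij) ?_⟩
  have h1 := hle 0 i (by omega)
  have h2 := hle j l.length hj
  have h3 : wordMetric S (z 0) (z l.length) = l.length := by rw [h0, hn, hl]; rfl
  have h4 := hS.wordMetric_triangle (z 0) (z i) (z l.length)
  have h5 := hS.wordMetric_triangle (z i) (z j) (z l.length)
  push_cast at h1
  linarith

/-- A left-invariant function whose increments along words are bounded grows at most linearly. -/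
theorem IsSymmGenSet.exists_le_wordMetric (hS : IsSymmGenSet S) {f : Γ → Γ → ℝ}
    (hf : IsLeftInvariant f) {c : ℝ} (h0 : f 1 1 ≤ 0)
    (htri : ∀ x y s, s ∈ S → f x (y * s) ≤ f x y + f y (y * s) + c) :
    ∃ A : ℝ, 0 ≤ A ∧ ∀ x y, f x y ≤ A * wordMetric S x y := by
  obtain ⟨M, hM⟩ := (hS.1.image (f 1)).bddAbove
  have hM' : ∀ s ∈ S, f 1 s ≤ M := fun s hs => hM ⟨s, hs, rfl⟩
  refine ⟨max (M + c) 0, le_max_right _ _, fun x y => ?_⟩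
  obtain ⟨l, hl, hlS, hlp⟩ := hS.exists_list (x⁻¹ * y)
  have main : ∀ l : List Γ, (∀ s ∈ l, s ∈ S) → f x (x * l.prod) ≤ max (M + c) 0 * l.length := by
    intro l
    induction l using List.reverseRecOn with
    | nil =>
      intro _
      have := hf x 1 1
      simp only [mul_one] at this
      simp [this, h0]
    | append_singleton l s ih =>
      intro hl
      have hs : s ∈ S := hl s (by simp)
      have h1 := ih fun s hs => hl s (by simp [hs])
      have h2 := htri x (x * l.prod) s hs
      have h3 := hf (x * l.prod) 1 s
      rw [mul_one] at h3
      have h4 := hM' s hs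
      have h5 := le_max_left (M + c) 0
      simp only [List.prod_append, List.prod_singleton, List.length_append, List.length_singleton,
        Nat.cast_add, Nat.cast_one, ← mul_assoc]
      linarith
  have := main l hlS
  rw [hlp, mul_inv_cancel_left, hl] at this
  exact this

/-- Elements of `𝒟_Γ` are quasi-isometric to every word metric. -/
theorem IsHyperbolicMetric.exists_quasiIsometric (hS : IsSymmGenSet S) {d : Γ → Γ → ℝ}
    (hd : IsHyperbolicMetric d) :
    ∃ A : ℝ, 0 ≤ A ∧ ∀ x y, d x y ≤ A * wordMetric S x y ∧ wordMetric S x y ≤ A * d x y + A := by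
  obtain ⟨A₁, hA₁, h1⟩ := hS.exists_le_wordMetric hd.leftInvariant (c := 0)
    (hd.pseudoMetric.self_eq_zero 1).le
    (fun x y s _ => by simpa using hd.pseudoMetric.triangle x y (y * s))
  obtain ⟨S', hS', l₁, l₂, C, hl₁, hl₂, hC, h2⟩ := hd.quasiIsometric
  obtain ⟨A₂, hA₂, h3⟩ := hS'.exists_le_wordMetric (wordMetric_leftInvariant S) (c := 0)
    (wordMetric_self S 1).le (fun x y s _ => by simpa using hS.wordMetric_triangle x y (y * s))
  have p1 : 0 ≤ A₂ / l₁ := by positivity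
  have p2 : 0 ≤ A₂ * C / l₁ := by positivity
  refine ⟨A₁ + A₂ / l₁ + A₂ * C / l₁, by positivity, fun x y => ⟨?_, ?_⟩⟩
  · refine (h1 x y).trans (mul_le_mul_of_nonneg_right (by linarith) ?_)
    unfold wordMetric; positivity
  · have h4 : wordMetric S' x y ≤ (d x y + C) / l₁ := by
      rw [le_div_iff₀ hl₁]
      linarith [(h2 x y).1]
    have h5 : wordMetric S x y ≤ A₂ * ((d x y + C) / l₁) :=
      (h3 x y).trans (mul_le_mul_of_nonneg_left h4 hA₂)
    have h6 : A₂ * ((d x y + C) / l₁) = A₂ / l₁ * d x y + A₂ * C / l₁ := by ring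
    have h7 := hd.pseudoMetric.nonneg x y
    nlinarith [mul_nonneg hA₁ h7, mul_nonneg p2 h7]

/-- Word geodesics are quasi-geodesics for any two elements of `𝒟_Γ`. -/
theorem exists_isQuasiGeodesic {d d' : Γ → Γ → ℝ} (hd : IsHyperbolicMetric d)
    (hd' : IsHyperbolicMetric d') : ∃ A : ℝ, 0 ≤ A ∧ ∀ x y, ∃ (z : ℕ → Γ) (n : ℕ),
      z 0 = x ∧ z n = y ∧ IsQuasiGeodesic d A z n ∧ IsQuasiGeodesic d' A z n := by
  obtain ⟨S, hS, -⟩ := hd.quasiIsometric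
  have key : ∀ {e : Γ → Γ → ℝ}, IsHyperbolicMetric e → ∃ B : ℝ, 0 ≤ B ∧ ∀ A, B ≤ A →
      ∀ (z : ℕ → Γ) (n : ℕ),
        (∀ i j : ℕ, i ≤ j → j ≤ n → wordMetric S (z i) (z j) = (j : ℝ) - i) →
        IsQuasiGeodesic e A z n := by
    intro e he
    obtain ⟨B, hB, h⟩ := he.exists_quasiIsometric hS
    refine ⟨B, hB, fun A hA z n hz i j hij hj => ?_⟩
    have h1 := h (z i) (z j)
    rw [hz i j hij hj] at h1
    have h2 : (0 : ℝ) ≤ (j : ℝ) - i := by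
      have : (i : ℝ) ≤ j := by exact_mod_cast hij
      linarith
    have h3 := he.pseudoMetric.nonneg (z i) (z j)
    have h4 := mul_le_mul_of_nonneg_right hA h2
    have h5 := mul_le_mul_of_nonneg_right hA h3
    exact ⟨by linarith, by linarith⟩
  obtain ⟨B, hB, h⟩ := key hd
  obtain ⟨B', hB', h'⟩ := key hd'
  refine ⟨B + B', by positivity, fun x y => ?_⟩
  obtain ⟨z, n, h0, hn, hz⟩ := hS.exists_geodesic x y
  exact ⟨z, n, h0, hn, h _ (by linarith) z n hz, h' _ (by linarith) z n hz⟩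

theorem exists_le_mul_add {d d' : Γ → Γ → ℝ} (hd : IsHyperbolicMetric d)
    (hd' : IsHyperbolicMetric d') : ∃ A : ℝ, 0 ≤ A ∧ ∀ x y, d x y ≤ A * d' x y + A := by
  obtain ⟨S, hS, -⟩ := hd.quasiIsometric
  obtain ⟨A, hA, h⟩ := hd.exists_quasiIsometric hS
  obtain ⟨B, hB, h'⟩ := hd'.exists_quasiIsometric hS
  refine ⟨A * B, by positivity, fun x y => ?_⟩
  have := mul_le_mul_of_nonneg_left (h' x y).2 hA
  linarith [(h x y).1]

end Word

/-! ### Rough geodesics -/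

theorem IsRoughGeodesic.gromovProd_le {X : Type*} {d : X → X → ℝ} (hd : IsPseudoMetric d)
    {C : ℝ} {γ : ℝ → X} {a b : ℝ} {x y : X} (h : IsRoughGeodesic d C γ a b x y) {t : ℝ}
    (ht : t ∈ Set.Icc a b) {w : X} {R : ℝ} (hw : d w (γ t) ≤ R) :
    gromovProd d x y w ≤ (3 * C + 2 * R) / 2 := by
  obtain ⟨hab, rfl, rfl, h⟩ := h
  have h1 := (h a ⟨le_rfl, hab⟩ t ht).2
  have h2 := (h t ht b ⟨hab, le_rfl⟩).2
  have h3 := (h a ⟨le_rfl, hab⟩ b ⟨hab, le_rfl⟩).1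
  rw [abs_of_nonpos (by linarith [ht.1, ht.2])] at h1 h2 h3
  have h4 := hd.triangle (γ a) (γ t) w
  have h5 := hd.triangle w (γ t) (γ b)
  have h6 := hd.symm w (γ t)
  unfold gromovProd
  linarith

/-- A discrete intermediate value theorem, used to reparametrize a quasi-geodesic by distance from
its starting point. -/
theorem exists_step_of_le {f : ℕ → ℝ} {K : ℝ} (hK : 0 ≤ K) (h0 : f 0 = 0) :
    ∀ n : ℕ, (∀ k < n, f (k + 1) ≤ f k + K) → ∀ t, 0 ≤ t → t ≤ f n →
      ∃ k ≤ n, f k ≤ t ∧ t ≤ f k + K := by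
  intro n
  induction n with
  | zero => intro _ t ht ht'; exact ⟨0, le_rfl, by linarith, by linarith⟩
  | succ n ih =>
    intro hs t ht ht'
    rcases le_total t (f n) with h | h
    · obtain ⟨k, hk, hk'⟩ := ih (fun k hk => hs k (by omega)) t ht h
      exact ⟨k, by omega, hk'⟩
    · exact ⟨n, by omega, h, by linarith [hs n (by omega)]⟩

section

variable {Γ : Type*} [Group Γ]

/-- Elements of `𝒟_Γ` are roughly geodesic, with rough geodesics that are also tight for a second
element of `𝒟_Γ`. -/
theorem exists_isRoughGeodesic {d d' : Γ → Γ → ℝ} (hd : IsHyperbolicMetric d)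
    (hd' : IsHyperbolicMetric d') : ∃ C : ℝ, 0 ≤ C ∧ ∀ x y, ∃ γ : ℝ → Γ,
      IsRoughGeodesic d C γ 0 (d x y + 1) x y ∧
        ∀ t ∈ Set.Icc 0 (d x y + 1), gromovProd d' x y (γ t) ≤ C := by
  have hp := hd.pseudoMetric
  obtain ⟨A, hA, hz⟩ := exists_isQuasiGeodesic hd hd'
  obtain ⟨C, hC, hM⟩ := IsQuasiGeodesic.exists_gromovProd_le hp hd.hyperbolic hA
  obtain ⟨C', hC', hM'⟩ :=
    IsQuasiGeodesic.exists_gromovProd_le hd'.pseudoMetric hd'.hyperbolic hA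
  refine ⟨2 * C + 2 * (A + 1) + C', by positivity, fun x y => ?_⟩
  obtain ⟨z, n, rfl, rfl, hzd, hzd'⟩ := hz x y
  -- By the Morse lemma the distance from the start measures distances along the path up to `2 * C`.
  have hmono : ∀ i j : ℕ, i ≤ j → j ≤ n →
      d (z i) (z j) ≤ d (z 0) (z j) - d (z 0) (z i) + 2 * C := by
    intro i j hij hj
    have := hM z n hzd 0 i j (by omega) hij hj
    unfold gromovProd at this
    linarith
  -- The extra unit of length keeps the two ends of the interval distinct, so both endpoints can be
  -- prescribed even when distinct points are at distance zero.
  have hex : ∀ t : ℝ, ∃ k : ℕ, k ≤ n ∧ (t ∈ Set.Icc 0 (d (z 0) (z n) + 1) →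
      |d (z 0) (z k) - t| ≤ A + 1) ∧ (t = 0 → k = 0) ∧ (t = d (z 0) (z n) + 1 → k = n) := by
    intro t
    have hL := hp.nonneg (z 0) (z n)
    by_cases h0 : t = 0
    · subst h0
      refine ⟨0, by omega, fun _ => ?_, fun _ => rfl, fun h => by linarith⟩
      rw [hp.self_eq_zero]; simp; linarith
    by_cases h1 : d (z 0) (z n) ≤ t
    · refine ⟨n, le_rfl, fun h => ?_, fun h => absurd h h0, fun _ => rfl⟩
      rw [abs_le]
      constructor <;> linarith [h.2]
    by_cases h2 : t < 0
    · exact ⟨0, by omega, fun h => by linarith [h.1], fun h => absurd h h0,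
        fun h => by linarith⟩
    push Not at h1 h2
    obtain ⟨k, hkn, hk, hk'⟩ := exists_step_of_le (f := fun k => d (z 0) (z k)) hA
      (hp.self_eq_zero (z 0)) n (fun k hk => by
        have h3 := (hzd k (k + 1) (by omega) (by omega)).1
        have h4 := hp.triangle (z 0) (z k) (z (k + 1))
        push_cast at h3
        linarith) t h2 h1.le
    refine ⟨k, hkn, fun _ => ?_, fun h => absurd h h0, fun h => by linarith⟩
    rw [abs_le]
    constructor <;> linarith
  choose k hkn hk hk0 hkL using hex
  have hL := hp.nonneg (z 0) (z n)
  refine ⟨fun t => z (k t), ⟨by linarith, by simp [hk0 0 rfl], by simp [hkL _ rfl], ?_⟩, ?_⟩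
  · intro s hs t ht
    have h1 := abs_le.1 (hk s hs)
    have h2 := abs_le.1 (hk t ht)
    have h3 : d (z (k s)) (z (k t)) ≤ |d (z 0) (z (k s)) - d (z 0) (z (k t))| + 2 * C := by
      rcases le_total (k s) (k t) with h | h
      · have := hmono _ _ h (hkn t)
        have := neg_abs_le (d (z 0) (z (k s)) - d (z 0) (z (k t)))
        linarith
      · have := hmono _ _ h (hkn s)
        rw [hp.symm] at this
        have := le_abs_self (d (z 0) (z (k s)) - d (z 0) (z (k t)))
        linarith
    have h4 : |d (z 0) (z (k s)) - d (z 0) (z (k t))| ≤ d (z (k s)) (z (k t)) := by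
      have e1 := hp.triangle (z 0) (z (k s)) (z (k t))
      have e2 := hp.triangle (z 0) (z (k t)) (z (k s))
      rw [hp.symm (z (k t)) (z (k s))] at e2
      rw [abs_le]
      constructor <;> linarith
    have h5 : |d (z 0) (z (k s)) - d (z 0) (z (k t))| ≤ |s - t| + 2 * (A + 1) := by
      have := neg_abs_le (s - t)
      have := le_abs_self (s - t)
      rw [abs_le]
      constructor <;> linarith
    have h6 : |s - t| ≤ |d (z 0) (z (k s)) - d (z 0) (z (k t))| + 2 * (A + 1) := by
      have := neg_abs_le (d (z 0) (z (k s)) - d (z 0) (z (k t)))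
      have := le_abs_self (d (z 0) (z (k s)) - d (z 0) (z (k t)))
      rw [abs_le]
      constructor <;> linarith
    constructor <;> linarith
  · intro t _
    have := hM' z n hzd' 0 (k t) n (by omega) (hkn t) le_rfl
    linarith

/-- A point of a rough geodesic at the height of the Gromov product is nearly as close as the
Gromov product allows. -/
theorem dist_le_gromovProd_add {X : Type*} {d : X → X → ℝ} (hd : IsPseudoMetric d) {δ : ℝ}
    (h4 : FourPoint d δ) {x y w p : X} {c : ℝ} (hp : gromovProd d x y p ≤ c)
    (hx : |d x p - gromovProd d w y x| ≤ c) :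
    d w p ≤ gromovProd d x y w + 3 * c + 2 * δ := by
  rw [abs_le] at hx
  unfold gromovProd at *
  have := hd.symm w x
  have := hd.symm p x
  have := hd.symm p y
  have := hd.symm y w
  rcases h4 w p x y with h | h <;> linarith

/-- Every pair of points admits a nearly nearest point on a rough geodesic. -/
theorem exists_center {d d' : Γ → Γ → ℝ} (hd : IsHyperbolicMetric d)
    (hd' : IsHyperbolicMetric d') : ∃ C : ℝ, 0 ≤ C ∧ ∀ x y w, ∃ p,
      gromovProd d' x y p ≤ C ∧ d w p ≤ gromovProd d x y w + C ∧
      gromovProd d x y p ≤ C ∧ |d x p - gromovProd d w y x| ≤ C ∧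
      ∃ γ : ℝ → Γ, IsRoughGeodesic d C γ 0 (d x y + 1) x y ∧
        ∃ t ∈ Set.Icc 0 (d x y + 1), γ t = p := by
  have hp := hd.pseudoMetric
  obtain ⟨δ, hδ, h4⟩ := hd.hyperbolic.exists_fourPoint hp
  obtain ⟨C, hC, h⟩ := exists_isRoughGeodesic hd hd'
  refine ⟨3 * (2 * C) + 2 * δ, by positivity, fun x y w => ?_⟩
  obtain ⟨γ, hγ, hγ'⟩ := h x y
  have ht : gromovProd d w y x ∈ Set.Icc 0 (d x y + 1) := by
    refine ⟨hp.gromovProd_nonneg _ _ _, ?_⟩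
    unfold gromovProd
    linarith [hp.triangle w y x, hp.triangle w x y, hp.symm x y, hp.symm x w]
  have h1 : gromovProd d x y (γ (gromovProd d w y x)) ≤ 2 * C := by
    have := hγ.gromovProd_le hp ht (hp.self_eq_zero _).le
    linarith
  have h2 : |d x (γ (gromovProd d w y x)) - gromovProd d w y x| ≤ C := by
    have := hγ.2.2.2 0 ⟨le_rfl, by linarith [hp.nonneg x y]⟩ _ ht
    rw [hγ.2.1, zero_sub, abs_neg, abs_of_nonneg ht.1] at this
    rw [abs_le]
    constructor <;> linarith
  refine ⟨γ (gromovProd d w y x), by linarith [hγ' _ ht], ?_, by linarith, by linarith, γ, ?_,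
    _, ht, rfl⟩
  · have := dist_le_gromovProd_add hp h4 h1 (h2.trans (by linarith))
    linarith
  · refine ⟨hγ.1, hγ.2.1, hγ.2.2.1, fun s hs t ht => ?_⟩
    have := hγ.2.2.2 s hs t ht
    constructor <;> linarith

theorem gromovProd_le_add_dist {X : Type*} {d : X → X → ℝ} (hd : IsPseudoMetric d)
    (x y w p : X) : gromovProd d x y w ≤ gromovProd d x y p + d w p := by
  have := hd.triangle x p w
  have := hd.triangle w p y
  have := hd.symm p w
  unfold gromovProd
  linarith

/-- Gromov products of two elements of `𝒟_Γ` are linearly comparable. -/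
theorem exists_gromovProd_le {d d' : Γ → Γ → ℝ} (hd : IsHyperbolicMetric d)
    (hd' : IsHyperbolicMetric d') : ∃ l : ℝ, 0 < l ∧ ∀ x y w,
      gromovProd d' x y w ≤ l * gromovProd d x y w + l := by
  obtain ⟨C, hC, h⟩ := exists_center hd hd'
  obtain ⟨A, hA, h'⟩ := exists_le_mul_add hd' hd
  refine ⟨A + A * C + A + C + 1, by positivity, fun x y w => ?_⟩
  obtain ⟨p, hp, hp', -⟩ := h x y w
  have h1 := gromovProd_le_add_dist hd'.pseudoMetric x y w p
  have h2 := h' w p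
  have h3 := mul_le_mul_of_nonneg_left hp' hA
  have h4 := hd.pseudoMetric.gromovProd_nonneg x y w
  nlinarith [mul_nonneg hA h4, mul_nonneg (mul_nonneg hA hC) h4, mul_nonneg hC h4]

end

/-! ### Potentials controlled by a hyperbolic metric -/

/-- The Gromov products of `ψ` are linearly controlled by those of `d`. -/
def IsControlled {X : Type*} (d ψ : X → X → ℝ) : Prop :=
  ∃ l : ℝ, 0 < l ∧ ∀ x y w : X, |gromovProd ψ x y w| ≤ l * gromovProd d x y w + l

theorem gromovProd_flip {X : Type*} (ψ : X → X → ℝ) (x y w : X) :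
    gromovProd (fun a b => ψ b a) x y w = gromovProd ψ y x w := by
  unfold gromovProd; ring

theorem gromovProd_comm {X : Type*} {d : X → X → ℝ} (hd : IsPseudoMetric d) (x y w : X) :
    gromovProd d x y w = gromovProd d y x w := by
  unfold gromovProd
  rw [hd.symm x w, hd.symm w y, hd.symm x y]; ring

theorem IsControlled.flip {X : Type*} {d ψ : X → X → ℝ} (hd : IsPseudoMetric d)
    (h : IsControlled d ψ) : IsControlled d (fun a b => ψ b a) := by
  obtain ⟨l, hl, h⟩ := h
  refine ⟨l, hl, fun x y w => ?_⟩
  rw [gromovProd_flip, gromovProd_comm hd]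
  exact h y x w

/-- With `p` a center of the triangle, the right side is bounded for the potentials considered, so
the product depends on `x` and `y` only through `p`. No symmetry of `ψ` is needed. -/
theorem gromovProd_sub_eq {X : Type*} (ψ : X → X → ℝ) (x y w p : X) :
    gromovProd ψ x y w - (ψ p w + ψ w p) / 2 =
      gromovProd ψ x y p - gromovProd ψ x w p - gromovProd ψ w y p := by
  unfold gromovProd; ring

/-- A point of a rough geodesic from `w` to `y` at the height of the Gromov product is a center
of the triangle with vertices `x, y, w`. -/
theorem gromovProd_center_le {X : Type*} {d : X → X → ℝ} (hd : IsPseudoMetric d) {δ : ℝ}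
    (hδ : 0 ≤ δ) (h4 : FourPoint d δ) {x y w p : X} {c : ℝ} (hp : gromovProd d w y p ≤ c)
    (hx : |d w p - gromovProd d x y w| ≤ c) :
    gromovProd d x y p ≤ 3 * c + 2 * δ ∧ gromovProd d x w p ≤ 3 * c + 2 * δ := by
  have h := dist_le_gromovProd_add hd h4 hp hx
  rw [abs_le] at hx
  have h0 : 0 ≤ c := (hd.gromovProd_nonneg _ _ _).trans hp
  have h1 := hd.symm x w
  have h2 := hd.symm p w
  have h3 := hd.symm y w
  unfold gromovProd at *
  constructor <;> linarith

theorem IsRoughGeodesic.mono {X : Type*} {d : X → X → ℝ} {C C' : ℝ} (hC : C ≤ C') {γ : ℝ → X}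
    {a b : ℝ} {x y : X} (h : IsRoughGeodesic d C γ a b x y) : IsRoughGeodesic d C' γ a b x y := by
  refine ⟨h.1, h.2.1, h.2.2.1, fun s hs t ht => ?_⟩
  have := h.2.2.2 s hs t ht
  constructor <;> linarith

section

variable {Γ : Type*} [Group Γ]

theorem mem_hyperbolicMetricPotentials_iff (d : HyperbolicMetric Γ) {ψ : Γ → Γ → ℝ} :
    ψ ∈ hyperbolicMetricPotentials Γ ↔ IsLeftInvariant ψ ∧ IsControlled d.1 ψ := by
  refine ⟨fun h => ⟨h.1, h.2 d⟩, fun h => ⟨h.1, fun d₀ => ?_⟩⟩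
  obtain ⟨l, hl, h1⟩ := h.2
  obtain ⟨m, hm, h2⟩ := exists_gromovProd_le d₀.2 d.2
  refine ⟨l * m + l, by positivity, fun x y w => ?_⟩
  have h3 := mul_le_mul_of_nonneg_left (h2 x y w) hl.le
  have h4 := h1 x y w
  have h5 := mul_nonneg hl.le (d₀.2.pseudoMetric.gromovProd_nonneg x y w)
  linarith

theorem IsControlled.roughGeodesicCondition {d : HyperbolicMetric Γ} {ψ : Γ → Γ → ℝ}
    (h : IsControlled d.1 ψ) : RoughGeodesicCondition d ψ := by
  obtain ⟨l, hl, h⟩ := h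
  refine ⟨0, le_rfl, fun C R hC hR => ⟨l * ((3 * C + 2 * R) / 2) + l, by positivity, ?_⟩⟩
  rintro x y γ a b hγ w ⟨t, ht, hw⟩
  refine (h x y w).trans ?_
  have := mul_le_mul_of_nonneg_left (hγ.gromovProd_le d.2.pseudoMetric ht hw) hl.le
  linarith

/-- A small $d$-product means that `w` is near a rough geodesic from `x` to `y`, where (RG) applies.
-/
theorem RoughGeodesicCondition.exists_abs_gromovProd_le {d : HyperbolicMetric Γ}
    {ψ : Γ → Γ → ℝ} (h : RoughGeodesicCondition d ψ) (K : ℝ) :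
    ∃ B : ℝ, 0 ≤ B ∧ ∀ x y w, gromovProd d.1 x y w ≤ K → |gromovProd ψ x y w| ≤ B := by
  obtain ⟨M, -, h⟩ := h
  obtain ⟨C, -, hc⟩ := exists_center d.2 d.2
  obtain ⟨B, hB, h⟩ := h (max M C) (max M (K + C)) (le_max_left _ _) (le_max_left _ _)
  refine ⟨B, hB, fun x y w hK => ?_⟩
  obtain ⟨p, -, hp, -, -, γ, hγ, t, ht, rfl⟩ := hc x y w
  exact h x y γ _ _ (hγ.mono (le_max_right _ _)) w
    ⟨t, ht, le_trans (by linarith) (le_max_right _ _)⟩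

/-- Left-invariant functions that are roughly additive along word geodesics grow at most
linearly. -/
theorem exists_le_of_abs_gromovProd_le {d : HyperbolicMetric Γ} {ψ : Γ → Γ → ℝ}
    (hψ : IsLeftInvariant ψ)
    (h : ∀ K : ℝ, ∃ B : ℝ, 0 ≤ B ∧ ∀ x y w, gromovProd d.1 x y w ≤ K → |gromovProd ψ x y w| ≤ B) :
    ∃ A : ℝ, 0 ≤ A ∧ ∀ x y, ψ x y ≤ A * d.1 x y + A := by
  have hp := d.2.pseudoMetric
  obtain ⟨S, hS, -⟩ := d.2.quasiIsometric
  obtain ⟨K, hK⟩ := (hS.1.image (d.1 1)).bddAbove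
  obtain ⟨B, hB, h⟩ := h K
  -- Subtracting `ψ 1 1` makes the function vanish on the diagonal; appending a letter then costs `2
  -- * B` from the bounded product, plus `ψ 1 1`.
  obtain ⟨A, hA, h1⟩ := hS.exists_le_wordMetric (f := fun x y => ψ x y - ψ 1 1)
    (c := 2 * B + ψ 1 1) (fun s x y => by simp [hψ s x y]) (by simp) (by
      intro x y s hs
      have h2 := h x (y * s) y (by
        have h3 : d.1 y (y * s) ≤ K := by
          have := d.2.leftInvariant y 1 s
          rw [mul_one] at this
          rw [this]
          exact hK ⟨s, hs, rfl⟩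
        have := hp.triangle x (y * s) y
        have := hp.symm y (y * s)
        unfold gromovProd
        linarith)
      rw [abs_le] at h2
      unfold gromovProd at h2
      linarith)
  obtain ⟨A', hA', h2⟩ := d.2.exists_quasiIsometric hS
  refine ⟨A * A' + |ψ 1 1|, by positivity, fun x y => ?_⟩
  have h3 := h1 x y
  have h4 := mul_le_mul_of_nonneg_left (h2 x y).2 hA
  have h5 := le_abs_self (ψ 1 1)
  have h6 := mul_nonneg (abs_nonneg (ψ 1 1)) (hp.nonneg x y)
  linarith

theorem RoughGeodesicCondition.isControlled {d : HyperbolicMetric Γ} {ψ : Γ → Γ → ℝ}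
    (hψ : IsLeftInvariant ψ) (h : RoughGeodesicCondition d ψ) : IsControlled d.1 ψ := by
  have hp := d.2.pseudoMetric
  have hb := h.exists_abs_gromovProd_le
  obtain ⟨A, hA, h1⟩ := exists_le_of_abs_gromovProd_le hψ hb
  obtain ⟨A', hA', h2⟩ := exists_le_of_abs_gromovProd_le (d := d) (ψ := fun x y => -ψ x y)
    (fun s x y => by simp [hψ s x y]) (fun K => by
      obtain ⟨B, hB, h⟩ := hb K
      refine ⟨B, hB, fun x y w hK => ?_⟩
      have e : gromovProd (fun x y => -ψ x y) x y w = -gromovProd ψ x y w := by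
        unfold gromovProd; ring
      rw [e, abs_neg]
      exact h x y w hK)
  obtain ⟨δ, hδ, h4⟩ := d.2.hyperbolic.exists_fourPoint hp
  obtain ⟨c, hc, hcen⟩ := exists_center d.2 d.2
  obtain ⟨B, hB, hb⟩ := hb (3 * c + 2 * δ)
  refine ⟨A + A' + (A + A') * c + 3 * B + 1, by positivity, fun x y w => ?_⟩
  -- The center lies on a rough geodesic from `w` to `y` at height `(x|y)_w`, so linear growth of
  -- `ψ` and `-ψ` bounds `ψ p w + ψ w p` by that product.
  obtain ⟨p, -, -, hp1, hp2, -⟩ := hcen w y x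
  obtain ⟨hp3, hp4⟩ := gromovProd_center_le hp hδ h4 hp1 hp2
  have b1 := abs_le.1 (hb _ _ _ hp3)
  have b2 := abs_le.1 (hb _ _ _ hp4)
  have b3 := abs_le.1 (hb w y p (by linarith))
  have e := gromovProd_sub_eq ψ x y w p
  have g0 := hp.gromovProd_nonneg x y w
  have hwp : d.1 w p ≤ gromovProd d.1 x y w + c := by linarith [(abs_le.1 hp2).2]
  have f1 := mul_le_mul_of_nonneg_left hwp hA
  have f2 := mul_le_mul_of_nonneg_left hwp hA'
  have l1 := h1 w p
  have l2 := h1 p w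
  have l3 := h2 w p
  have l4 := h2 p w
  rw [hp.symm p w] at l2 l4
  have n1 := mul_nonneg hA g0
  have n2 := mul_nonneg hA' g0
  have n3 := mul_nonneg (mul_nonneg (add_nonneg hA hA') hc) g0
  have n4 := mul_nonneg hB g0
  have n5 := mul_nonneg hA hc
  have n6 := mul_nonneg hA' hc
  rw [abs_le]
  constructor <;> nlinarith

/-- Points with comparable Gromov products have comparable products with respect to a
controlled function. -/
theorem IsControlled.exists_abs_sub_le_left {d : HyperbolicMetric Γ} {ψ : Γ → Γ → ℝ}
    (h : IsControlled d.1 ψ) (c : ℝ) : ∃ C : ℝ, 0 ≤ C ∧ ∀ x x' y w,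
      |gromovProd d.1 x y w - gromovProd d.1 x' y w| ≤ c →
        |gromovProd ψ x y w - gromovProd ψ x' y w| ≤ C := by
  have hp := d.2.pseudoMetric
  obtain ⟨l, hl, h⟩ := h
  obtain ⟨δ, hδ, h4⟩ := d.2.hyperbolic.exists_fourPoint hp
  obtain ⟨r, hr, hcen⟩ := exists_center d.2 d.2
  have key : ∀ x y w, gromovProd d.1 x y w ≤ 3 * (r + |c|) + 2 * δ →
      |gromovProd ψ x y w| ≤ l * (3 * (r + |c|) + 2 * δ) + l := fun x y w hK =>
    (h x y w).trans (by linarith [mul_le_mul_of_nonneg_left hK hl.le])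
  refine ⟨6 * (l * (3 * (r + |c|) + 2 * δ) + l), by positivity, fun x x' y w hx => ?_⟩
  obtain ⟨p, -, -, hp1, hp2, -⟩ := hcen w y x
  have hc := le_abs_self c
  have hc0 := abs_nonneg c
  have hp1' : gromovProd d.1 w y p ≤ r + |c| := by linarith
  -- The same `p` is a center for `x', y, w`, so the symmetrized term cancels in the difference.
  have hp2' : |d.1 w p - gromovProd d.1 x' y w| ≤ r + |c| :=
    (abs_sub_le _ (gromovProd d.1 x y w) _).trans (by linarith)
  obtain ⟨a1, a2⟩ := gromovProd_center_le hp hδ h4 hp1' (hp2.trans (by linarith) : _ ≤ r + |c|)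
  obtain ⟨a3, a4⟩ := gromovProd_center_le hp hδ h4 hp1' hp2'
  have b1 := abs_le.1 (key _ _ _ a1)
  have b2 := abs_le.1 (key _ _ _ a2)
  have b3 := abs_le.1 (key _ _ _ a3)
  have b4 := abs_le.1 (key _ _ _ a4)
  have b5 := abs_le.1 (key w y p (by linarith))
  have e := gromovProd_sub_eq ψ x y w p
  have e' := gromovProd_sub_eq ψ x' y w p
  rw [abs_le]
  constructor <;> linarith

theorem IsControlled.exists_abs_sub_le {d : HyperbolicMetric Γ} {ψ : Γ → Γ → ℝ}
    (h : IsControlled d.1 ψ) (c : ℝ) : ∃ C : ℝ, 0 ≤ C ∧ ∀ x x' y y' w,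
      |gromovProd d.1 x y w - gromovProd d.1 x' y w| ≤ c →
      |gromovProd d.1 x' y w - gromovProd d.1 x' y' w| ≤ c →
        |gromovProd ψ x y w - gromovProd ψ x' y' w| ≤ C := by
  have hp := d.2.pseudoMetric
  obtain ⟨C, hC, h1⟩ := h.exists_abs_sub_le_left c
  obtain ⟨C', hC', h2⟩ := (h.flip hp).exists_abs_sub_le_left c
  refine ⟨C + C', by positivity, fun x x' y y' w hx hy => ?_⟩
  have h3 := h1 x x' y w hx
  have h4 := h2 y y' x' w (by rwa [gromovProd_comm hp y, gromovProd_comm hp y'])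
  rw [gromovProd_flip ψ y, gromovProd_flip ψ y'] at h4
  exact (abs_sub_le _ (gromovProd ψ x' y w) _).trans (by linarith)

/-! ### Quasi-extension to the boundary -/

theorem exists_represents (d : HyperbolicMetric Γ) (ξ : Γ ⊕ GromovBoundary d) :
    ∃ x : ℕ → Γ, Represents d x ξ := by
  rcases ξ with g | ξ
  · exact ⟨fun _ => g, Eventually.of_forall fun _ => rfl⟩
  · obtain ⟨⟨x, hx⟩, rfl⟩ := Quotient.exists_rep ξ
    exact ⟨x, hx, rfl⟩

theorem Represents.eventually_eq_or_le {d : HyperbolicMetric Γ} {ξ : Γ ⊕ GromovBoundary d}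
    {x x' : ℕ → Γ} (h : Represents d x ξ) (h' : Represents d x' ξ) (K : ℝ) :
    ∀ᶠ p : ℕ × ℕ in atTop, x p.1 = x' p.2 ∨ K ≤ gromovProd d.1 (x p.1) (x' p.2) 1 := by
  rcases ξ with g | ξ
  · have := Filter.Eventually.prod_mk h h'
    rw [prod_atTop_atTop_eq] at this
    filter_upwards [this] with p hp
    left; rw [hp.1, hp.2]
  · obtain ⟨hx, rfl⟩ := h
    obtain ⟨hx', he⟩ := h'
    have : GromovProdTendsto d.1 x' x := Quotient.exact he
    filter_upwards [(gromovProdTendsto_symm d this).eventually_ge_atTop K] with p hp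
    exact Or.inr hp

theorem gromovProd_le_dist {X : Type*} {d : X → X → ℝ} (hd : IsPseudoMetric d) (x y w : X) :
    gromovProd d x y w ≤ d x w := by
  have := hd.triangle w x y
  have := hd.symm x w
  unfold gromovProd
  linarith

theorem FourPoint.min_gromovProd_le {X : Type*} {d : X → X → ℝ} (hd : IsPseudoMetric d) {δ : ℝ}
    (h4 : FourPoint d δ) {K : ℝ} {x y z w : X} (h1 : K ≤ gromovProd d x y w)
    (h2 : K ≤ gromovProd d y z w) : K - δ ≤ gromovProd d x z w := by
  have := hd.symm x w
  have := hd.symm y w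
  have := hd.symm z w
  have := hd.symm z y
  unfold gromovProd at *
  rcases h4 x z y w with h | h <;> linarith

/-- For distinct boundary points some product with large indices is below `K`; if another exceeded
`K + 2 * δ`, the chain `x n, x p.1, y p.2, y m` would contradict this. -/
theorem Represents.exists_eventually_le {d : HyperbolicMetric Γ} {ξ η : Γ ⊕ GromovBoundary d}
    (hne : ¬ ∃ ζ : GromovBoundary d, ξ = Sum.inr ζ ∧ η = Sum.inr ζ) {x y : ℕ → Γ}
    (hx : Represents d x ξ) (hy : Represents d y η) :
    ∃ K : ℝ, ∀ᶠ p : ℕ × ℕ in atTop, gromovProd d.1 (x p.1) (y p.2) 1 ≤ K := by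
  have hp := d.2.pseudoMetric
  have hfst : Tendsto (Prod.fst : ℕ × ℕ → ℕ) atTop atTop := by
    rw [← prod_atTop_atTop_eq]
    exact tendsto_fst
  have hsnd : Tendsto (Prod.snd : ℕ × ℕ → ℕ) atTop atTop := by
    rw [← prod_atTop_atTop_eq]
    exact tendsto_snd
  rcases ξ with g | ξ
  · refine ⟨d.1 g 1, ?_⟩
    filter_upwards [hfst.eventually hx] with p h
    rw [h]; exact gromovProd_le_dist hp _ _ _
  rcases η with g | η
  · refine ⟨d.1 g 1, ?_⟩
    filter_upwards [hsnd.eventually hy] with p h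
    rw [h, gromovProd_comm hp]; exact gromovProd_le_dist hp _ _ _
  obtain ⟨hx, rfl⟩ := hx
  obtain ⟨hy, rfl⟩ := hy
  have hnt : ¬ GromovProdTendsto d.1 x y := fun h =>
    hne ⟨_, rfl, congrArg Sum.inr (Quotient.sound (gromovProdTendsto_symm d h))⟩
  obtain ⟨δ, hδ, h4⟩ := d.2.hyperbolic.exists_fourPoint hp
  rw [GromovProdTendsto, tendsto_atTop] at hnt
  push Not at hnt
  obtain ⟨K, hK⟩ := hnt
  refine ⟨K + 2 * δ, ?_⟩
  have hx' := hx.eventually_ge_atTop (K + 2 * δ)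
  have hy' := hy.eventually_ge_atTop (K + 2 * δ)
  rw [eventually_atTop] at hx' hy' ⊢
  obtain ⟨⟨a, a'⟩, ha⟩ := hx'
  obtain ⟨⟨b, b'⟩, hb⟩ := hy'
  obtain ⟨⟨n, m⟩, hnm, hlt⟩ := frequently_atTop.1 hK (max a a', max b b')
  refine ⟨(max a a', max b b'), fun p hp' => ?_⟩
  by_contra hcon
  push Not at hcon
  have k1 := ha (n, p.1) ⟨(le_max_left _ _).trans hnm.1, (le_max_right _ _).trans hp'.1⟩
  have k2 := hb (p.2, m) ⟨(le_max_left _ _).trans hp'.2, (le_max_right _ _).trans hnm.2⟩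
  have k3 := h4.min_gromovProd_le hp k1 hcon.le
  have k4 := h4.min_gromovProd_le hp k3 (by dsimp only at k2 ⊢; linarith)
  dsimp only at k4 hlt
  linarith

/-- The margin `δ + 1` ensures that, in the four-point minimum bounding `(x|y)` below, the term
`(x|x')` is never the smaller one. -/
theorem FourPoint.abs_gromovProd_sub_le {X : Type*} {d : X → X → ℝ} (hd : IsPseudoMetric d)
    {δ : ℝ} (hδ : 0 ≤ δ) (h4 : FourPoint d δ) {K : ℝ} {x x' y w : X}
    (hx : x = x' ∨ K + δ + 1 ≤ gromovProd d x x' w) (hK : gromovProd d x y w ≤ K) :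
    |gromovProd d x y w - gromovProd d x' y w| ≤ δ := by
  rcases hx with rfl | hx
  · simpa using hδ
  have h1 := h4.min_gromovProd_le hd (K := gromovProd d x y w) (x := x') (y := x) (z := y)
    (by rw [gromovProd_comm hd x']; linarith) le_rfl
  have h2 := h4.min_gromovProd_le hd (K := min (K + δ + 1) (gromovProd d x' y w))
    ((min_le_left _ _).trans hx) (min_le_right _ _)
  rw [abs_le]
  refine ⟨?_, by linarith⟩
  rcases min_choice (K + δ + 1) (gromovProd d x' y w) with h | h <;> rw [h] at h2 <;> linarith

theorem IsControlled.exists_eventually_abs_sub_le {d : HyperbolicMetric Γ} {ψ : Γ → Γ → ℝ}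
    (h : IsControlled d.1 ψ) : ∃ C : ℝ, 0 ≤ C ∧ ∀ ξ η : Γ ⊕ GromovBoundary d,
      (¬ ∃ ζ : GromovBoundary d, ξ = Sum.inr ζ ∧ η = Sum.inr ζ) →
      ∀ x x' y y' : ℕ → Γ, Represents d x ξ → Represents d x' ξ →
        Represents d y η → Represents d y' η → ∀ᶠ p : ℕ × ℕ in atTop,
          |gromovProd ψ (x p.1) (y p.1) 1 - gromovProd ψ (x' p.2) (y' p.2) 1| ≤ C := by
  have hp := d.2.pseudoMetric
  obtain ⟨δ, hδ, h4⟩ := d.2.hyperbolic.exists_fourPoint hp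
  obtain ⟨C, hC, h⟩ := h.exists_abs_sub_le δ
  refine ⟨C, hC, fun ξ η hne x x' y y' hx hx' hy hy' => ?_⟩
  obtain ⟨K, hK⟩ := hx.exists_eventually_le hne hy
  obtain ⟨K', hK'⟩ := hx'.exists_eventually_le hne hy
  have hswap : Tendsto (Prod.swap : ℕ × ℕ → ℕ × ℕ) atTop atTop := by
    rw [← prod_atTop_atTop_eq]
    exact tendsto_prod_swap
  have hdiag : Tendsto (fun p : ℕ × ℕ => (p.1, p.1)) atTop atTop := by
    refine tendsto_atTop_diagonal.comp ?_
    rw [← prod_atTop_atTop_eq]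
    exact tendsto_fst
  filter_upwards [hdiag.eventually hK, hswap.eventually hK', hx.eventually_eq_or_le hx' (K + δ + 1),
    hy.eventually_eq_or_le hy' (K' + δ + 1)] with p k1 k2 k3 k4
  refine h _ _ _ _ _ (h4.abs_gromovProd_sub_le hp hδ k3 k1) ?_
  rw [gromovProd_comm hp, gromovProd_comm hp _ (y' p.2)]
  refine h4.abs_gromovProd_sub_le hp hδ k4 ?_
  rw [gromovProd_comm hp]
  exact k2

theorem IsControlled.quasiExtension {d : HyperbolicMetric Γ} {ψ : Γ → Γ → ℝ}
    (h : IsControlled d.1 ψ) : QuasiExtension d ψ := by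
  obtain ⟨C, hC, h⟩ := h.exists_eventually_abs_sub_le
  have hex : ∀ ξ η : Γ ⊕ GromovBoundary d, ∃ e : ℝ,
      (∀ x y : Γ, ξ = Sum.inl x → η = Sum.inl y → e = gromovProd ψ x y 1) ∧
      ((¬ ∃ ζ : GromovBoundary d, ξ = Sum.inr ζ ∧ η = Sum.inr ζ) →
        ∀ x y : ℕ → Γ, Represents d x ξ → Represents d y η →
          ∀ᶠ n in atTop, |gromovProd ψ (x n) (y n) 1 - e| ≤ 2 * C) := by
    intro ξ η
    by_cases hne : ∃ ζ : GromovBoundary d, ξ = Sum.inr ζ ∧ η = Sum.inr ζ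
    · obtain ⟨ζ, rfl, rfl⟩ := hne
      exact ⟨0, fun x y hx => by simp at hx, fun hn => absurd ⟨ζ, rfl, rfl⟩ hn⟩
    obtain ⟨a, ha⟩ := exists_represents d ξ
    obtain ⟨b, hb⟩ := exists_represents d η
    -- The extension is the product at one late index of fixed representatives. Taking `N` after
    -- constant sequences stabilize makes it exact on `Γ`; comparison through these representatives
    -- costs `C` twice.
    obtain ⟨N, hN, hN1, hN2⟩ : ∃ N, (∀ᶠ m in atTop,
        |gromovProd ψ (a N) (b N) 1 - gromovProd ψ (a m) (b m) 1| ≤ C) ∧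
        (∀ x, ξ = Sum.inl x → a N = x) ∧ (∀ y, η = Sum.inl y → b N = y) := by
      have h1 := h ξ η hne a a b b ha ha hb hb
      rw [← prod_atTop_atTop_eq] at h1
      have h2 : ∀ᶠ N in atTop, ∀ x, ξ = Sum.inl x → a N = x := by
        rcases ξ with g | ξ
        · filter_upwards [show ∀ᶠ n in atTop, a n = g from ha] with n hn x hx
          rw [hn]; exact Sum.inl.inj hx
        · simp
      have h3 : ∀ᶠ N in atTop, ∀ x, η = Sum.inl x → b N = x := by
        rcases η with g | η
        · filter_upwards [show ∀ᶠ n in atTop, b n = g from hb] with n hn x hx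
          rw [hn]; exact Sum.inl.inj hx
        · simp
      exact (h1.curry.and (h2.and h3)).exists
    refine ⟨gromovProd ψ (a N) (b N) 1, fun x y hx hy => by rw [hN1 x hx, hN2 y hy],
      fun _ x y hx hy => ?_⟩
    have h1 := tendsto_atTop_diagonal.eventually (h ξ η hne a x b y ha hx hb hy)
    filter_upwards [hN, h1] with n k1 k2
    rw [abs_le] at *
    constructor <;> linarith
  choose E hE hE' using hex
  refine ⟨E, fun x y => hE _ _ x y rfl rfl, 2 * C, by positivity, ?_⟩
  intro ξ η hne x x' y y' hx hx' hy hy'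
  have h1 := hE' ξ η hne x y hx hy
  have h2 := hE' ξ η hne x' y' hx' hy'
  constructor
  · refine EReal.sub_le_of_le_add ?_
    refine limsup_le_of_le (by isBoundedDefault) ?_
    filter_upwards [h1] with n hn
    rw [← EReal.coe_add, EReal.coe_le_coe_iff]
    linarith [(abs_le.1 hn).2]
  · rw [← EReal.sub_le_iff_le_add (Or.inl (EReal.coe_ne_bot _)) (Or.inl (EReal.coe_ne_top _))]
    refine le_liminf_of_le (by isBoundedDefault) ?_
    filter_upwards [h2] with n hn
    rw [← EReal.coe_sub, EReal.coe_le_coe_iff]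
    linarith [(abs_le.1 hn).1]

end

theorem proposition3p1 {Γ : Type*} [Group Γ] (hΓ : IsNonelementaryHyperbolic Γ)
    (d : HyperbolicMetric Γ) :
    hyperbolicMetricPotentials Γ = temperedPotentials d := by
  ext ψ
  rw [mem_hyperbolicMetricPotentials_iff d]
  exact ⟨fun h => ⟨h.1, h.2.quasiExtension, h.2.roughGeodesicCondition⟩,
    fun h => ⟨h.1, h.2.2.isControlled h.1⟩⟩
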